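/- Let $X_1, X_2, \dots$ be i.i.d. standard Cauchy random variables, i.e. with density $\frac{1}{\pi(x^2+1)}$ on $\mathbb{R}$. Then $$\frac{1}{n^2}\sum_{i=1}^n X_i^2 \longrightarrow W \quad\text{in distribution as } n\to\infty,$$ where $W$ is an almost surely positive random variable with characteristic function $$\varphi_W(t)=\mathbb{E}\,e^{itW}=\exp\left(-2\sqrt{\frac{-it}{\pi}}\right),\qquad t\in\mathbb{R},$$ (principal branch of the square root) and with probability density $$f_W(w)=\frac{e^{-1/(\pi w)}}{\pi w^{3/2}}\ \text{ for } w>0,\qquad f_W(w)=0\ \text{ for } w\le 0.$$ That is, $W$ has the Lévy law with location $0$ and scale $c=2/\pi$, whose density is $\sqrt{\tfrac{c}{2\pi}}\,e^{-c/(2w)}\,w^{-3/2}$ for $w>0$; this law is strictly stable of index $\tfrac12$: it is non-degenerate and, for independent copies $W_1,W_2$ of $W$ and $a,b>0$, the variable $aW_1+bW_2$ has the law of $(\sqrt a+\sqrt b)^2\,W$. Moreover, $$\frac{n}{\sqrt{\sum_{i=1}^n X_i^2}} \longrightarrow U=\frac{1}{\sqrt{W}} \quad\text{in distribution as } n\to\infty,$$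 and $U$ has the half-normal density $$f_U(u)=\frac{2}{\pi}\,e^{-u^2/\pi}\ \text{ for } u>0,\qquad f_U(u)=0\ \text{ for } u\le 0,$$ i.e. $U$ has the law of $|Z|$ with $Z\sim N(0,\pi/2)$. -/

import Mathlib

open MeasureTheory ProbabilityTheory Filter
open scoped Real NNReal ENNReal

/-- Density of the Lévy law with location `0` and scale `c > 0`:
`√(c / (2π)) * exp (-c / (2x)) / x ^ (3/2)` for `x > 0`, and `0` elsewhere. -/
noncomputable def levyPDFReal (c x : ℝ) : ℝ :=
  if 0 < x then √(c / (2 * π)) * Real.exp (-c / (2 * x)) / x ^ (3 / 2 : ℝ) else 0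

/-- The Lévy law with location `0` and scale `c > 0`. -/
noncomputable def levyMeasure (c : ℝ) : Measure ℝ :=
  volume.withDensity fun x => ENNReal.ofReal (levyPDFReal c x)

/-- The half-normal law: the law of `|Z|` for a centred normal `Z` of variance `v`. -/
noncomputable def halfNormalMeasure (v : ℝ≥0) : Measure ℝ :=
  (gaussianReal 0 v).map fun z => |z|

/-- A non-degenerate probability law `μ` on `ℝ` is strictly stable of index `α > 0` if, for
independent `W₁, W₂ ∼ μ` and all `a, b > 0`, the variable `a W₁ + b W₂` has the law of
`(a ^ α + b ^ α) ^ (1 / α) W₁`. -/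
structure IsStrictlyStable (α : ℝ) (μ : Measure ℝ) : Prop where
  index_pos : 0 < α
  isProbabilityMeasure : IsProbabilityMeasure μ
  nondegenerate : ∀ x : ℝ, μ ≠ Measure.dirac x
  map_eq : ∀ a b : ℝ, 0 < a → 0 < b →
    (μ.prod μ).map (fun p : ℝ × ℝ => a * p.1 + b * p.2) =
      μ.map fun x => (a ^ α + b ^ α) ^ (1 / α) * x

/-- The density `exp (-1 / (π w)) / (π w ^ (3/2))` for `w > 0`, and `0` elsewhere. -/
noncomputable def limitPDFW (w : ℝ) : ℝ :=
  if 0 < w then Real.exp (-(1 / (π * w))) / (π * w ^ (3 / 2 : ℝ)) else 0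

/-- The density `(2 / π) exp (-u ^ 2 / π)` for `u > 0`, and `0` elsewhere. -/
noncomputable def limitPDFU (u : ℝ) : ℝ :=
  if 0 < u then 2 / π * Real.exp (-(u ^ 2 / π)) else 0

open scoped Topology

/-! The limit is realised as `W = 1 / Z ^ 2` with `Z ∼ N(0, π/2)`, and Lévy's continuity theorem
reduces the convergence to characteristic functions. With `w = -it` and `φ` that of `X ^ 2`, the
point is that `n (φ(t / n ^ 2) - 1) → -2 √(w / π)`. The substitution `x = n y` turns the left side
into an integral converging to `π⁻¹ ∫ (exp (-w y ^ 2) - 1) / y ^ 2`, whose value is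
`integral_cexp_sub_one_div_sq`.

On the Gaussian side, the Cauchy–Schlömilch transformation gives `E exp (-s / Z ^ 2) = exp (-2 √(s /
π))` for real `s > 0`. Both computations are made where `Re w > 0` and pass to the imaginary axis by
continuity.

The densities come from the change of variables `w = 1 / u ^ 2`, stability from the square-root
homogeneity of the exponent, and the limit `U` from continuous mapping on `(0, ∞)`. -/

/-! ### The integral of `(exp (-w y ^ 2) - 1) / y ^ 2` for `Re w ≥ 0` -/

theorem continuousOn_cpow_half : ContinuousOn (fun w : ℂ => w ^ (1 / 2 : ℂ)) {w | 0 ≤ w.re} := by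
  intro w hw
  refine ContinuousAt.continuousWithinAt ?_
  -- The branch cut meets the closed half-plane only at `0`, where the positive exponent gives
  -- continuity.
  rcases eq_or_ne w 0 with rfl | h0
  · have h := Complex.continuousAt_cpow_const_of_re_pos (z := 0) (w := 1 / 2) (by simp) (by norm_num)
    exact h
  · refine continuousAt_cpow_const ?_
    rw [Complex.mem_slitPlane_iff]
    rcases (show 0 ≤ w.re from hw).lt_or_eq with h | h
    · exact Or.inl h
    · refine Or.inr fun him => h0 (Complex.ext h.symm him)

theorem closure_re_pos : closure {w : ℂ | 0 < w.re} = {w : ℂ | 0 ≤ w.re} :=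
  Complex.closure_setOfPred_lt_re 0

theorem norm_cexp_sub_one_le_two {z : ℂ} (hz : z.re ≤ 0) : ‖Complex.exp z - 1‖ ≤ 2 := by
  refine (norm_sub_le _ _).trans ?_
  rw [Complex.norm_exp, norm_one]
  linarith [Real.exp_le_one_iff.2 hz]

theorem norm_cexp_sub_one_le_two_mul {z : ℂ} (hz : z.re ≤ 0) :
    ‖Complex.exp z - 1‖ ≤ 2 * ‖z‖ := by
  rcases le_total ‖z‖ 1 with h | h
  · exact Complex.norm_exp_sub_one_le h
  · exact (norm_cexp_sub_one_le_two hz).trans (by linarith)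

/-- The bound `2` controls large `y` and `2 ‖w‖ y ^ 2` controls small `y`. Their combination is an
integrable majorant, locally uniform in `w` up to the imaginary axis. -/
theorem norm_cexp_neg_mul_sq_sub_one_div_le {w : ℂ} (hw : 0 ≤ w.re) (y : ℝ) :
    ‖Complex.exp (-w * y ^ 2) - 1‖ / y ^ 2 ≤ (2 + 2 * ‖w‖) * (1 + y ^ 2)⁻¹ := by
  have hre : (-w * (y : ℂ) ^ 2).re ≤ 0 := by
    rw [← Complex.ofReal_pow, Complex.re_mul_ofReal, Complex.neg_re]
    nlinarith [sq_nonneg y]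
  have h1 := norm_cexp_sub_one_le_two hre
  have h2 := norm_cexp_sub_one_le_two_mul hre
  rw [norm_mul, norm_neg, norm_pow, Complex.norm_real, Real.norm_eq_abs, sq_abs] at h2
  rcases eq_or_ne y 0 with rfl | hy
  · simp; positivity
  · have hy2 : 0 < y ^ 2 := by positivity
    rw [← div_eq_mul_inv, div_le_div_iff₀ hy2 (by positivity)]
    nlinarith

theorem integrable_const_mul_inv_one_add_sq (c : ℝ) :
    Integrable fun y : ℝ => c * (1 + y ^ 2)⁻¹ :=
  integrable_inv_one_add_sq.const_mul c

theorem norm_cexp_sub_one_div_sq (w : ℂ) (y : ℝ) :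
    ‖(Complex.exp (-w * y ^ 2) - 1) / (y : ℂ) ^ 2‖ =
      ‖Complex.exp (-w * y ^ 2) - 1‖ / y ^ 2 := by
  rw [norm_div, norm_pow, Complex.norm_real, Real.norm_eq_abs, sq_abs]

theorem continuousOn_integral_cexp_sub_one_div_sq :
    ContinuousOn (fun w : ℂ => ∫ y : ℝ, (Complex.exp (-w * y ^ 2) - 1) / (y : ℂ) ^ 2)
      {w | 0 ≤ w.re} := by
  intro w₀ hw₀
  refine continuousWithinAt_of_dominated
    (bound := fun y => (2 + 2 * (‖w₀‖ + 1)) * (1 + y ^ 2)⁻¹) ?_ ?_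
    (integrable_const_mul_inv_one_add_sq _) ?_
  · exact Eventually.of_forall fun w =>
      (by fun_prop : Measurable fun y : ℝ =>
        (Complex.exp (-w * y ^ 2) - 1) / (y : ℂ) ^ 2).aestronglyMeasurable
  · have : ∀ᶠ w in 𝓝[{w : ℂ | 0 ≤ w.re}] w₀, ‖w‖ < ‖w₀‖ + 1 :=
      (continuous_norm.continuousWithinAt).eventually_lt_const (by linarith)
    filter_upwards [this, self_mem_nhdsWithin] with w hw hre
    refine Eventually.of_forall fun y => ?_
    rw [norm_cexp_sub_one_div_sq]
    refine (norm_cexp_neg_mul_sq_sub_one_div_le hre y).trans ?_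
    gcongr
  · refine Eventually.of_forall fun y => Continuous.continuousWithinAt ?_
    fun_prop

/-- Differentiating in `w` cancels `y ^ 2` and leaves a complex Gaussian integral. -/
theorem hasDerivAt_integral_cexp_sub_one_div_sq {w : ℂ} (hw : 0 < w.re) :
    HasDerivAt (fun w : ℂ => ∫ y : ℝ, (Complex.exp (-w * y ^ 2) - 1) / (y : ℂ) ^ 2)
      (-(π / w) ^ (1 / 2 : ℂ)) w := by
  have hball : ∀ z ∈ Metric.ball w (w.re / 2), w.re / 2 ≤ z.re := by
    intro z hz
    have h1 := (Complex.abs_re_le_norm (z - w)).trans_lt (mem_ball_iff_norm.1 hz)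
    rw [Complex.sub_re] at h1
    linarith [(abs_lt.1 h1).1]
  have key := hasDerivAt_integral_of_dominated_loc_of_deriv_le (μ := (volume : Measure ℝ))
    (F := fun (w : ℂ) (y : ℝ) => (Complex.exp (-w * y ^ 2) - 1) / (y : ℂ) ^ 2)
    (F' := fun (w : ℂ) (y : ℝ) => -Complex.exp (-w * y ^ 2)) (x₀ := w)
    (bound := fun y => Real.exp (-(w.re / 2) * y ^ 2))
    (Metric.ball_mem_nhds w (half_pos hw)) ?_ ?_ ?_ ?_ ?_ ?_
  · have h := key.2
    rwa [integral_neg, integral_gaussian_complex hw] at h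
  · exact Eventually.of_forall fun w =>
      (by fun_prop : Measurable fun y : ℝ =>
        (Complex.exp (-w * y ^ 2) - 1) / (y : ℂ) ^ 2).aestronglyMeasurable
  · refine (integrable_const_mul_inv_one_add_sq (2 + 2 * ‖w‖)).mono'
      (by fun_prop : Measurable fun y : ℝ =>
        (Complex.exp (-w * y ^ 2) - 1) / (y : ℂ) ^ 2).aestronglyMeasurable ?_
    refine Eventually.of_forall fun y => ?_
    rw [norm_cexp_sub_one_div_sq]
    exact norm_cexp_neg_mul_sq_sub_one_div_le hw.le y
  · exact (by fun_prop : Measurable fun y : ℝ =>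
      -Complex.exp (-w * y ^ 2)).aestronglyMeasurable
  · refine Eventually.of_forall fun y z hz => ?_
    rw [norm_neg, Complex.norm_exp, ← Complex.ofReal_pow, Complex.re_mul_ofReal, Complex.neg_re]
    have := hball z hz
    gcongr
  · exact integrable_exp_neg_mul_sq (half_pos hw)
  -- At `y = 0` the integrand is identically `0`, so its derivative there is not `-1`; the point is
  -- discarded as null.
  · have h0 : ∀ᵐ y : ℝ, y ≠ 0 := by simp [ae_iff]
    filter_upwards [h0] with y hy z _
    have hy' : (y : ℂ) ^ 2 ≠ 0 := by simpa using hy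
    have h := (((hasDerivAt_id z).neg.mul_const ((y : ℂ) ^ 2)).cexp.sub_const 1).div_const
      ((y : ℂ) ^ 2)
    convert! h using 1
    simp only [Pi.neg_apply, id_eq]
    rw [neg_one_mul, mul_neg, neg_div, mul_div_cancel_right₀ _ hy']

/-- A positive factor leaves the argument unchanged, so the principal logarithm is additive here. -/
theorem ofReal_mul_cpow_half {a : ℝ} (ha : 0 < a) (w : ℂ) :
    ((a : ℂ) * w) ^ (1 / 2 : ℂ) = (√a : ℂ) * w ^ (1 / 2 : ℂ) := by
  rcases eq_or_ne w 0 with rfl | hw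
  · simp
  have ha' : (a : ℂ) ≠ 0 := by exact_mod_cast ha.ne'
  rw [Complex.cpow_def_of_ne_zero (mul_ne_zero ha' hw), Complex.cpow_def_of_ne_zero hw,
    Complex.log_ofReal_mul ha hw, add_mul, Complex.exp_add, Real.sqrt_eq_rpow,
    Complex.ofReal_cpow ha.le, Complex.cpow_def_of_ne_zero ha', Complex.ofReal_log ha.le]
  norm_num

/-- Both sides have the same derivative on the open half-plane, which is connected, so they differ
by a constant there, hence on the closure. At `w = 0` both vanish. -/
theorem integral_cexp_sub_one_div_sq {w : ℂ} (hw : 0 ≤ w.re) :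
    ∫ y : ℝ, (Complex.exp (-w * y ^ 2) - 1) / (y : ℂ) ^ 2 = -2 * (√π * w ^ (1 / 2 : ℂ)) := by
  have hopen : IsOpen {w : ℂ | 0 < w.re} := isOpen_lt continuous_const Complex.continuous_re
  set f := fun w : ℂ => (∫ y : ℝ, (Complex.exp (-w * y ^ 2) - 1) / (y : ℂ) ^ 2) +
    2 * (√π * w ^ (1 / 2 : ℂ)) with hf
  have hcont : ContinuousOn f {w | 0 ≤ w.re} :=
    continuousOn_integral_cexp_sub_one_div_sq.add
      (continuousOn_const.mul (continuousOn_const.mul continuousOn_cpow_half))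
  have hderiv : ∀ z ∈ {w : ℂ | 0 < w.re}, HasDerivAt f 0 z := by
    intro z hz
    have hslit : z ∈ Complex.slitPlane := Or.inl hz
    have h := (hasDerivAt_integral_cexp_sub_one_div_sq hz).add
      ((((hasDerivAt_id z).cpow_const (c := 1 / 2) hslit).const_mul (√π : ℂ)).const_mul 2)
    refine h.congr_deriv ?_
    rw [div_eq_mul_inv, ofReal_mul_cpow_half Real.pi_pos,
      Complex.inv_cpow _ _ (Complex.slitPlane_arg_ne_pi hslit), ← Complex.cpow_neg]
    simp only [id_eq]
    rw [show (1 / 2 - 1 : ℂ) = -(1 / 2) by norm_num]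
    ring
  obtain ⟨c, hc⟩ := hopen.exists_is_const_of_deriv_eq_zero (𝕜 := ℂ)
    (convex_halfSpace_re_gt 0).isPreconnected
    (fun z hz => (hderiv z hz).differentiableAt.differentiableWithinAt)
    (fun z hz => (hderiv z hz).deriv)
  have hc' : Set.EqOn f (fun _ => c) {w | 0 ≤ w.re} :=
    Set.EqOn.of_subset_closure hc hcont continuousOn_const
      (fun z (hz : 0 < z.re) => (le_of_lt hz : 0 ≤ z.re)) closure_re_pos.ge
  have h0 := hc' (show (0 : ℂ) ∈ {w : ℂ | 0 ≤ w.re} by simp)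
  have h1 := hc' hw
  simp only [hf] at h0 h1
  simp at h0
  rw [← h0] at h1
  linear_combination h1

/-! ### Limit of the characteristic functions of the Cauchy sums -/

theorem nat_mul_integral_cauchyPDFReal_mul {n : ℕ} (hn : n ≠ 0) (w : ℂ) :
    (n : ℂ) * ∫ x : ℝ, (cauchyPDFReal 0 1 x : ℂ) * (Complex.exp (-(w / n ^ 2) * x ^ 2) - 1) =
      ∫ y : ℝ, (π⁻¹ : ℂ) * ((n : ℂ) ^ 2 * (1 + (n : ℂ) ^ 2 * y ^ 2)⁻¹ *
        (Complex.exp (-w * y ^ 2) - 1)) := by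
  have h := Measure.integral_comp_mul_left
    (fun x : ℝ => (cauchyPDFReal 0 1 x : ℂ) * (Complex.exp (-(w / n ^ 2) * x ^ 2) - 1)) (n : ℝ)
  have hn' : (n : ℂ) ≠ 0 := by exact_mod_cast hn
  have h2 : ∫ x : ℝ, (cauchyPDFReal 0 1 x : ℂ) * (Complex.exp (-(w / n ^ 2) * x ^ 2) - 1) =
      (n : ℂ) * ∫ y : ℝ, (cauchyPDFReal 0 1 (n * y) : ℂ) *
        (Complex.exp (-(w / n ^ 2) * (n * y : ℝ) ^ 2) - 1) := by
    rw [h, abs_of_nonneg (by positivity), Complex.real_smul]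
    push_cast
    rw [mul_inv_cancel_left₀ hn']
  rw [h2, ← integral_const_mul, ← integral_const_mul]
  refine integral_congr_ae (Eventually.of_forall fun y => ?_)
  have he : -(w / n ^ 2) * ((n * y : ℝ) : ℂ) ^ 2 = -w * (y : ℂ) ^ 2 := by
    push_cast
    field_simp
  simp only [he, cauchyPDFReal]
  push_cast
  rw [show ((n : ℂ) * y - 0) ^ 2 + 1 ^ 2 = 1 + (n : ℂ) ^ 2 * y ^ 2 by ring]
  ring

/-- Dominated convergence: the kernel `n ^ 2 / (1 + n ^ 2 y ^ 2)` is at most `1 / y ^ 2` and tends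
to it for `y ≠ 0`. -/
theorem tendsto_nat_mul_integral_cauchyPDFReal_mul {w : ℂ} (hw : 0 ≤ w.re) :
    Tendsto (fun n : ℕ => (n : ℂ) *
      ∫ x : ℝ, (cauchyPDFReal 0 1 x : ℂ) * (Complex.exp (-(w / n ^ 2) * x ^ 2) - 1)) atTop
      (𝓝 (-2 * (w / π) ^ (1 / 2 : ℂ))) := by
  have hval : -2 * (w / π) ^ (1 / 2 : ℂ) = ∫ y : ℝ, (π⁻¹ : ℂ) *
      ((Complex.exp (-w * y ^ 2) - 1) / (y : ℂ) ^ 2) := by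
    rw [integral_const_mul, integral_cexp_sub_one_div_sq hw, div_eq_inv_mul, ← Complex.ofReal_inv,
      ofReal_mul_cpow_half (inv_pos.2 Real.pi_pos)]
    have h : (√π⁻¹ : ℂ) = (π⁻¹ : ℝ) * √π := by
      norm_cast
      rw [Real.sqrt_inv, inv_mul_eq_div, Real.sqrt_div_self]
    push_cast at h ⊢
    rw [h]
    ring
  rw [hval]
  have hcongr : (fun n : ℕ => ∫ y : ℝ, (π⁻¹ : ℂ) * ((n : ℂ) ^ 2 * (1 + (n : ℂ) ^ 2 * y ^ 2)⁻¹ *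
      (Complex.exp (-w * y ^ 2) - 1))) =ᶠ[atTop] fun n : ℕ => (n : ℂ) *
      ∫ x : ℝ, (cauchyPDFReal 0 1 x : ℂ) * (Complex.exp (-(w / n ^ 2) * x ^ 2) - 1) := by
    filter_upwards [eventually_ne_atTop 0] with n hn
    exact (nat_mul_integral_cauchyPDFReal_mul hn w).symm
  refine Tendsto.congr' hcongr ?_
  refine tendsto_integral_of_dominated_convergence
    (fun y => π⁻¹ * ((2 + 2 * ‖w‖) * (1 + y ^ 2)⁻¹)) ?_
    ((integrable_const_mul_inv_one_add_sq _).const_mul _) ?_ ?_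
  · exact fun n => (by fun_prop : Measurable fun y : ℝ => (π⁻¹ : ℂ) *
      ((n : ℂ) ^ 2 * (1 + (n : ℂ) ^ 2 * y ^ 2)⁻¹ *
      (Complex.exp (-w * y ^ 2) - 1))).aestronglyMeasurable
  · refine fun n => Eventually.of_forall fun y => ?_
    have hb := norm_cexp_neg_mul_sq_sub_one_div_le hw y
    have hp : ‖(π⁻¹ : ℂ)‖ = π⁻¹ := by
      rw [norm_inv, Complex.norm_real, Real.norm_of_nonneg Real.pi_pos.le]
    have hr : (n : ℂ) ^ 2 * (1 + (n : ℂ) ^ 2 * y ^ 2)⁻¹ =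
        (((n : ℝ) ^ 2 * (1 + (n : ℝ) ^ 2 * y ^ 2)⁻¹ : ℝ) : ℂ) := by push_cast; rfl
    rw [norm_mul, norm_mul, hp, hr, Complex.norm_real, Real.norm_of_nonneg (by positivity)]
    refine mul_le_mul_of_nonneg_left (le_trans ?_ hb) (by positivity)
    rcases eq_or_ne y 0 with rfl | hy
    · simp
    · rw [div_eq_inv_mul]
      refine mul_le_mul_of_nonneg_right ?_ (norm_nonneg _)
      have hy2 : 0 < y ^ 2 := by positivity
      rw [← div_eq_mul_inv, div_le_iff₀ (by positivity)]
      have : (y ^ 2)⁻¹ * (1 + (n : ℝ) ^ 2 * y ^ 2) = (y ^ 2)⁻¹ + (n : ℝ) ^ 2 := by field_simp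
      rw [this]
      linarith [inv_pos.2 hy2]
  · have h0 : ∀ᵐ y : ℝ, y ≠ 0 := by simp [ae_iff]
    filter_upwards [h0] with y hy
    refine Tendsto.const_mul _ ?_
    rw [div_eq_inv_mul]
    refine Tendsto.mul_const _ ?_
    have hlim : Tendsto (fun n : ℕ => ((((n : ℝ) ^ 2)⁻¹ + y ^ 2)⁻¹ : ℝ)) atTop
        (𝓝 ((0 + y ^ 2)⁻¹)) := by
      refine Tendsto.inv₀ (Tendsto.add_const _ ?_) (by positivity)
      exact tendsto_inv_atTop_zero.comp
        ((tendsto_pow_atTop two_ne_zero).comp tendsto_natCast_atTop_atTop)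
    have hlim' := (Complex.continuous_ofReal.tendsto _).comp hlim
    rw [zero_add] at hlim'
    push_cast at hlim'
    refine hlim'.congr' ?_
    filter_upwards [eventually_ne_atTop 0] with n hn
    have hn' : (n : ℂ) ^ 2 ≠ 0 := by exact_mod_cast pow_ne_zero 2 hn
    simp only [Function.comp_apply]
    push_cast
    rw [show (1 : ℂ) + (n : ℂ) ^ 2 * y ^ 2 = (n : ℂ) ^ 2 * (((n : ℂ) ^ 2)⁻¹ + y ^ 2) by
      rw [mul_add, mul_inv_cancel₀ hn'], mul_inv, mul_inv_cancel_left₀ hn']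

theorem charFun_map_sq_cauchyMeasure_sub_one (s : ℝ) :
    charFun ((cauchyMeasure 0 1).map fun x => x ^ 2) s - 1 =
      ∫ x : ℝ, (cauchyPDFReal 0 1 x : ℂ) *
        (Complex.exp (-(-(Complex.I * s)) * x ^ 2) - 1) := by
  have h1 : (1 : ℂ) = ∫ _ : ℝ, (1 : ℂ) ∂(cauchyMeasure 0 1) := by simp
  rw [charFun_apply_real, integral_map (by fun_prop) (by fun_prop)]
  nth_rewrite 1 [h1]
  rw [← integral_sub, cauchyMeasure_of_scale_ne_zero _ one_ne_zero,
    integral_withDensity_eq_integral_toReal_smul (by fun_prop)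
      (Eventually.of_forall fun x => by simp [cauchyPDF])]
  · refine integral_congr_ae (Eventually.of_forall fun x => ?_)
    simp only [cauchyPDF, ENNReal.toReal_ofReal (cauchyPDF_pos 0 one_ne_zero x).le,
      Complex.real_smul]
    congr 3
    push_cast
    ring
  · refine Integrable.of_bound (by fun_prop) 1 (Eventually.of_forall fun x => ?_)
    rw [← Complex.ofReal_mul, Complex.norm_exp_ofReal_mul_I]
  · exact integrable_const _

/-- This is `(1 + g n) ^ n → exp a` when `n * g n → a`, at the boundary point `w = -it`. -/
theorem tendsto_charFun_map_sq_cauchyMeasure_pow (t : ℝ) :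
    Tendsto (fun n : ℕ => charFun ((cauchyMeasure 0 1).map fun x => x ^ 2)
      (((n : ℝ) ^ 2)⁻¹ * t) ^ n) atTop
      (𝓝 (Complex.exp (-2 * (-(Complex.I * t) / π) ^ (1 / 2 : ℂ)))) := by
  have h := tendsto_nat_mul_integral_cauchyPDFReal_mul (w := -(Complex.I * t)) (by simp)
  have h2 := Complex.tendsto_one_add_pow_exp_of_tendsto (g := fun n : ℕ =>
    charFun ((cauchyMeasure 0 1).map fun x => x ^ 2) (((n : ℝ) ^ 2)⁻¹ * t) - 1)
    (t := -2 * (-(Complex.I * t) / π) ^ (1 / 2 : ℂ)) ?_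
  · simpa using h2
  · refine h.congr fun n => ?_
    rw [charFun_map_sq_cauchyMeasure_sub_one]
    congr! 8
    push_cast
    ring

/-! ### The Cauchy–Schlömilch integral -/

theorem image_const_div_Ioi {c : ℝ} (hc : 0 < c) :
    (fun x : ℝ => c / x) '' Set.Ioi 0 = Set.Ioi 0 := by
  ext y
  constructor
  · rintro ⟨x, hx, rfl⟩
    exact div_pos hc hx
  · intro hy
    exact ⟨c / y, div_pos hc hy, by simp; field_simp⟩

/-- The preimage of `y` is the positive root of `x ^ 2 - y x - c = 0`. -/
theorem image_sub_const_div_Ioi {c : ℝ} (hc : 0 < c) :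
    (fun x : ℝ => x - c / x) '' Set.Ioi 0 = Set.univ := by
  refine Set.eq_univ_of_forall fun y => ?_
  have h1 : y ^ 2 < y ^ 2 + 4 * c := by linarith
  have h2 : |y| < √(y ^ 2 + 4 * c) := by
    rw [← Real.sqrt_sq_eq_abs]
    exact Real.sqrt_lt_sqrt (sq_nonneg y) h1
  have h3 : √(y ^ 2 + 4 * c) ^ 2 = y ^ 2 + 4 * c := Real.sq_sqrt (by positivity)
  have hpos : 0 < (y + √(y ^ 2 + 4 * c)) / 2 := by linarith [neg_abs_le y]
  refine ⟨_, hpos, ?_⟩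
  have hne : y + √(y ^ 2 + 4 * c) ≠ 0 := by linarith
  simp only
  field_simp
  nlinarith

theorem hasDerivAt_const_div (c : ℝ) {x : ℝ} (hx : x ≠ 0) :
    HasDerivAt (fun x : ℝ => c / x) (-(c / x ^ 2)) x := by
  have h := (hasDerivAt_inv hx).const_mul c
  simp only [← div_eq_mul_inv] at h
  refine h.congr_deriv ?_
  field_simp

theorem exp_neg_sub_div_sq {c x : ℝ} (hx : x ≠ 0) :
    Real.exp (-(x - c / x) ^ 2) = Real.exp (2 * c) * Real.exp (-x ^ 2 - c ^ 2 / x ^ 2) := by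
  rw [← Real.exp_add]
  congr 1
  field_simp
  ring

theorem integrableOn_exp_neg_sub_div_sq (c : ℝ) :
    IntegrableOn (fun x : ℝ => Real.exp (-(x - c / x) ^ 2)) (Set.Ioi 0) := by
  have h : IntegrableOn (fun x : ℝ => Real.exp (2 * c) * Real.exp (-1 * x ^ 2)) (Set.Ioi 0) :=
    ((integrable_exp_neg_mul_sq one_pos).const_mul _).integrableOn
  refine Integrable.mono' h
    (by fun_prop : Measurable fun x : ℝ => Real.exp (-(x - c / x) ^ 2)).aestronglyMeasurable ?_
  filter_upwards [ae_restrict_mem measurableSet_Ioi] with x hx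
  rw [exp_neg_sub_div_sq (ne_of_gt hx), Real.norm_of_nonneg (by positivity)]
  have : 0 ≤ c ^ 2 / x ^ 2 := by positivity
  gcongr
  linarith

/-- The Cauchy–Schlömilch transformation of the Gaussian integral. -/
theorem integral_exp_neg_sub_div_sq {c : ℝ} (hc : 0 < c) :
    ∫ x in Set.Ioi (0 : ℝ), Real.exp (-(x - c / x) ^ 2) = √π / 2 := by
  have hinj : Set.InjOn (fun x : ℝ => c / x) (Set.Ioi 0) := by
    intro x hx y hy h
    have hx' : x ≠ 0 := ne_of_gt hx
    have hy' : y ≠ 0 := ne_of_gt hy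
    simp only at h
    field_simp at h
    exact h.symm
  have hd : ∀ x ∈ Set.Ioi (0 : ℝ),
      HasDerivWithinAt (fun x : ℝ => c / x) (-(c / x ^ 2)) (Set.Ioi 0) x :=
    fun x hx => (hasDerivAt_const_div c (ne_of_gt hx)).hasDerivWithinAt
  have hcongr : Set.EqOn (fun x : ℝ => |-(c / x ^ 2)| • Real.exp (-(c / x - c / (c / x)) ^ 2))
      (fun x => c / x ^ 2 * Real.exp (-(x - c / x) ^ 2)) (Set.Ioi 0) := by
    intro x hx
    have hx' : x ≠ 0 := ne_of_gt hx
    simp only [abs_neg, smul_eq_mul]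
    rw [abs_of_nonneg (by positivity), div_div_cancel₀ hc.ne']
    ring_nf
  -- The involution `x ↦ c / x` only changes the sign of `x - c / x`, so the integral is unchanged
  -- by inserting the weight `c / x ^ 2`.
  have h1 := integral_image_eq_integral_abs_deriv_smul measurableSet_Ioi hd hinj
    (fun x => Real.exp (-(x - c / x) ^ 2))
  rw [image_const_div_Ioi hc, setIntegral_congr_fun measurableSet_Ioi hcongr] at h1
  have hi2 : IntegrableOn (fun x => c / x ^ 2 * Real.exp (-(x - c / x) ^ 2)) (Set.Ioi 0) := by
    have := (integrableOn_image_iff_integrableOn_abs_deriv_smul measurableSet_Ioi hd hinj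
      (fun x => Real.exp (-(x - c / x) ^ 2))).1
    rw [image_const_div_Ioi hc] at this
    exact (this (integrableOn_exp_neg_sub_div_sq c)).congr_fun hcongr measurableSet_Ioi
  have hd3 : ∀ x ∈ Set.Ioi (0 : ℝ),
      HasDerivWithinAt (fun x : ℝ => x - c / x) (1 + c / x ^ 2) (Set.Ioi 0) x := by
    intro x hx
    have h := ((hasDerivAt_id x).sub (hasDerivAt_const_div c (ne_of_gt hx))).hasDerivWithinAt
      (s := Set.Ioi 0)
    simpa [sub_neg_eq_add] using! h
  have hmono : MonotoneOn (fun x : ℝ => x - c / x) (Set.Ioi 0) := by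
    intro x hx y hy hxy
    have hx' : (0 : ℝ) < x := hx
    have : c / y ≤ c / x := by gcongr
    simp only
    linarith
  -- The substitution `u = x - c / x` has Jacobian `1 + c / x ^ 2` and maps onto `ℝ`, so the two
  -- equal integrals add up to the full Gaussian integral `√π`.
  have h3 := integral_image_eq_integral_deriv_smul_of_monotoneOn measurableSet_Ioi hd3 hmono
    (fun u => Real.exp (-1 * u ^ 2))
  rw [image_sub_const_div_Ioi hc, setIntegral_univ, integral_gaussian, div_one] at h3
  have h4 : ∫ x in Set.Ioi (0 : ℝ), (1 + c / x ^ 2) • Real.exp (-1 * (x - c / x) ^ 2) =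
      (∫ x in Set.Ioi (0 : ℝ), Real.exp (-(x - c / x) ^ 2)) +
      ∫ x in Set.Ioi (0 : ℝ), c / x ^ 2 * Real.exp (-(x - c / x) ^ 2) := by
    rw [← integral_add (integrableOn_exp_neg_sub_div_sq c) hi2]
    refine setIntegral_congr_fun measurableSet_Ioi fun x _ => ?_
    simp only [smul_eq_mul, neg_one_mul]
    ring
  linarith

theorem integral_exp_neg_sq_sub_div_sq {c : ℝ} (hc : 0 < c) :
    ∫ x in Set.Ioi (0 : ℝ), Real.exp (-x ^ 2 - c ^ 2 / x ^ 2) =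
      √π / 2 * Real.exp (-2 * c) := by
  have h := integral_exp_neg_sub_div_sq hc
  rw [setIntegral_congr_fun measurableSet_Ioi
    (fun x hx => exp_neg_sub_div_sq (c := c) (ne_of_gt hx)), integral_const_mul] at h
  rw [← h, mul_right_comm, ← Real.exp_add]
  simp

/-! ### The Laplace transform of `1 / Z ^ 2` -/

theorem gaussianPDFReal_pi_div_two (x : ℝ) :
    gaussianPDFReal 0 (π / 2).toNNReal x = π⁻¹ * Real.exp (-(x ^ 2 / π)) := by
  have h : ((π / 2).toNNReal : ℝ) = π / 2 := Real.coe_toNNReal _ (by positivity)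
  rw [gaussianPDFReal, h, show 2 * π * (π / 2) = π ^ 2 by ring, Real.sqrt_sq Real.pi_pos.le]
  congr 2
  field_simp
  ring

theorem pi_div_two_toNNReal_ne_zero : (π / 2).toNNReal ≠ 0 := by
  rw [Ne, Real.toNNReal_eq_zero, not_le]
  positivity

/-- By evenness the integral folds onto the half-line; rescaling by `√π` then gives the previous
integral with `c = √(s / π)`. -/
theorem integral_exp_neg_mul_inv_sq_gaussianReal {s : ℝ} (hs : 0 < s) :
    ∫ z, Real.exp (-s * (z ^ 2)⁻¹) ∂(gaussianReal 0 (π / 2).toNNReal) =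
      Real.exp (-2 * √(s / π)) := by
  have hπ := Real.pi_pos
  have hsq : 0 < √π := Real.sqrt_pos.2 hπ
  rw [integral_gaussianReal_eq_integral_smul pi_div_two_toNNReal_ne_zero]
  have h1 : ∀ z : ℝ, gaussianPDFReal 0 (π / 2).toNNReal z • Real.exp (-s * (z ^ 2)⁻¹) =
      (fun u : ℝ => π⁻¹ * Real.exp (-(u ^ 2 / π) - s * (u ^ 2)⁻¹)) |z| := by
    intro z
    simp only [gaussianPDFReal_pi_div_two, smul_eq_mul, sq_abs, mul_assoc, ← Real.exp_add]
    ring_nf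
  refine (integral_congr_ae (Eventually.of_forall h1)).trans ((integral_comp_abs
    (f := fun u : ℝ => π⁻¹ * Real.exp (-(u ^ 2 / π) - s * (u ^ 2)⁻¹))).trans ?_)
  rw [integral_const_mul]
  have h2 := integral_comp_mul_left_Ioi (fun u : ℝ => Real.exp (-(u ^ 2 / π) - s * (u ^ 2)⁻¹)) 0 hsq
  rw [mul_zero] at h2
  have h3 : ∫ x in Set.Ioi (0 : ℝ), Real.exp (-((√π * x) ^ 2 / π) - s * ((√π * x) ^ 2)⁻¹) =
      √π / 2 * Real.exp (-2 * √(s / π)) := by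
    rw [← integral_exp_neg_sq_sub_div_sq (Real.sqrt_pos.2 (div_pos hs hπ))]
    refine setIntegral_congr_fun measurableSet_Ioi fun x hx => ?_
    have hx' : x ≠ 0 := ne_of_gt hx
    simp only [mul_pow, Real.sq_sqrt hπ.le, Real.sq_sqrt (div_pos hs hπ).le]
    congr 1
    field_simp
  rw [h3, smul_eq_mul] at h2
  have h4 : ∫ u in Set.Ioi (0 : ℝ), Real.exp (-(u ^ 2 / π) - s * (u ^ 2)⁻¹) =
      π / 2 * Real.exp (-2 * √(s / π)) := by
    have := congrArg (fun r => √π * r) h2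
    simp only [mul_inv_cancel_left₀ hsq.ne'] at this
    rw [← this, ← mul_assoc, ← mul_div_assoc, Real.mul_self_sqrt hπ.le]
  rw [h4]
  field_simp

theorem norm_cexp_neg_mul_inv_sq_le_one {w : ℂ} (hw : 0 ≤ w.re) (z : ℝ) :
    ‖Complex.exp (-w * ((z ^ 2)⁻¹ : ℝ))‖ ≤ 1 := by
  rw [Complex.norm_exp, Complex.re_mul_ofReal, Complex.neg_re, Real.exp_le_one_iff]
  have : 0 ≤ (z ^ 2)⁻¹ := by positivity
  nlinarith

/-- Both sides are analytic for `Re w > 0` and agree on the positive reals, so the identity theorem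
applies; continuity then reaches the imaginary axis. -/
theorem integral_cexp_neg_mul_inv_sq_gaussianReal {w : ℂ} (hw : 0 ≤ w.re) :
    ∫ z, Complex.exp (-w * ((z ^ 2)⁻¹ : ℝ)) ∂(gaussianReal 0 (π / 2).toNNReal) =
      Complex.exp (-2 * (w / π) ^ (1 / 2 : ℂ)) := by
  set γ := gaussianReal 0 (π / 2).toNNReal
  have hmeas : ∀ w : ℂ, AEStronglyMeasurable
      (fun z : ℝ => Complex.exp (-w * ((z ^ 2)⁻¹ : ℝ))) γ := fun w =>
    (by fun_prop : Measurable fun z : ℝ => Complex.exp (-w * ((z ^ 2)⁻¹ : ℝ))).aestronglyMeasurable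
  set F := fun w : ℂ => ∫ z, Complex.exp (-w * ((z ^ 2)⁻¹ : ℝ)) ∂γ with hF
  set G := fun w : ℂ => Complex.exp (-2 * (w / π) ^ (1 / 2 : ℂ)) with hG
  have hopen : IsOpen {w : ℂ | 0 < w.re} := isOpen_lt continuous_const Complex.continuous_re
  have hFcont : ContinuousOn F {w | 0 ≤ w.re} := by
    refine continuousOn_of_dominated (bound := fun _ => 1) (fun w _ => hmeas w)
      (fun w hw => Eventually.of_forall (norm_cexp_neg_mul_inv_sq_le_one hw)) (integrable_const _)
      (Eventually.of_forall fun z => Continuous.continuousOn (by fun_prop))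
  have hdiv : ∀ {w : ℂ}, 0 ≤ w.re → 0 ≤ (w / π).re := by
    intro w hw
    rw [Complex.div_ofReal_re]
    exact div_nonneg hw Real.pi_pos.le
  have hGcont : ContinuousOn G {w | 0 ≤ w.re} := by
    refine Complex.continuous_exp.comp_continuousOn (continuousOn_const.mul ?_)
    exact continuousOn_cpow_half.comp (by fun_prop) fun z hz => hdiv hz
  have hFan : AnalyticOnNhd ℂ F {w | 0 < w.re} := by
    -- `F w` is the complex moment generating function of `1 / z ^ 2` at `-w`, and for `t < 0` the
    -- exponential `exp (t / z ^ 2)` is bounded by `1`.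
    have hsub : Set.Iio (0 : ℝ) ⊆ interior (integrableExpSet (fun z : ℝ => (z ^ 2)⁻¹) γ) := by
      refine interior_maximal (fun t ht => ?_) isOpen_Iio
      refine Integrable.of_bound (by fun_prop : Measurable fun z : ℝ =>
        Real.exp (t * (z ^ 2)⁻¹)).aestronglyMeasurable 1 (Eventually.of_forall fun z => ?_)
      rw [Real.norm_of_nonneg (by positivity), Real.exp_le_one_iff]
      exact mul_nonpos_of_nonpos_of_nonneg (le_of_lt ht) (by positivity)
    intro w hw
    have h := analyticAt_complexMGF (X := fun z : ℝ => (z ^ 2)⁻¹) (μ := γ) (z := -w)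
      (hsub (by simpa using hw))
    exact h.comp analyticAt_id.neg
  have hGan : AnalyticOnNhd ℂ G {w | 0 < w.re} := by
    refine DifferentiableOn.analyticOnNhd (fun w hw => ?_) hopen
    refine DifferentiableAt.differentiableWithinAt ?_
    refine DifferentiableAt.cexp (DifferentiableAt.const_mul ?_ _)
    refine DifferentiableAt.cpow_const (by fun_prop) (Or.inl ?_)
    rw [Complex.div_ofReal_re]
    exact div_pos hw Real.pi_pos
  have hreal : ∀ s : ℝ, 0 < s → F s = G s := by
    intro s hs
    have h := congrArg (fun r : ℝ => (r : ℂ)) (integral_exp_neg_mul_inv_sq_gaussianReal hs)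
    simp only [← integral_complex_ofReal] at h
    simp only [hF, hG]
    have h2 : ((s : ℂ) / π) ^ (1 / 2 : ℂ) = (√(s / π) : ℝ) := by
      rw [Real.sqrt_eq_rpow, Complex.ofReal_cpow (by positivity)]
      norm_num
    rw [h2]
    push_cast at h ⊢
    exact h
  have hfreq : ∃ᶠ z in 𝓝[≠] (1 : ℂ), F z = G z := by
    have hT : Tendsto (fun x : ℝ => (x : ℂ)) (𝓝[≠] 1) (𝓝[≠] 1) := by
      refine tendsto_nhdsWithin_iff.2 ⟨?_, ?_⟩
      · exact (Complex.continuous_ofReal.tendsto' 1 1 (by simp)).mono_left nhdsWithin_le_nhds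
      · filter_upwards [self_mem_nhdsWithin] with x hx
        simpa using hx
    refine hT.frequently (Eventually.frequently ?_)
    filter_upwards [mem_nhdsWithin_of_mem_nhds (Ioi_mem_nhds (zero_lt_one (α := ℝ)))] with x hx
    exact hreal x hx
  have hEq := hFan.eqOn_of_preconnected_of_frequently_eq hGan
    (convex_halfSpace_re_gt 0).isPreconnected (z₀ := 1) (by simp) hfreq
  exact Set.EqOn.of_subset_closure hEq hFcont hGcont
    (fun z (hz : 0 < z.re) => (le_of_lt hz : 0 ≤ z.re)) closure_re_pos.ge hw

/-! ### Densities of `W` and `U` -/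

theorem levyPDFReal_two_div_pi : levyPDFReal (2 / π) = limitPDFW := by
  have hπ := Real.pi_pos
  ext w
  unfold levyPDFReal limitPDFW
  split_ifs with hw
  · have h1 : √(2 / π / (2 * π)) = π⁻¹ := by
      rw [show 2 / π / (2 * π) = (π⁻¹) ^ 2 by field_simp, Real.sqrt_sq (by positivity)]
    rw [h1, show -(2 / π) / (2 * w) = -(1 / (π * w)) by field_simp]
    field_simp
  · rfl

theorem setLIntegral_Iio_zero (f : ℝ → ℝ≥0∞) :
    ∫⁻ x in Set.Iio 0, f x = ∫⁻ x in Set.Ioi 0, f (-x) := by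
  have h := (Measure.measurePreserving_neg (volume : Measure ℝ)).setLIntegral_comp_preimage_emb
    (Homeomorph.neg ℝ).measurableEmbedding f (Set.Iio 0)
  rw [← h]
  simp

theorem lintegral_comp_abs (f : ℝ → ℝ≥0∞) :
    ∫⁻ x : ℝ, f |x| = 2 * ∫⁻ x in Set.Ioi 0, f x := by
  have hpos : ∫⁻ x in Set.Ioi (0 : ℝ), f |x| = ∫⁻ x in Set.Ioi 0, f x :=
    setLIntegral_congr_fun measurableSet_Ioi fun x hx => by rw [abs_of_pos hx]
  rw [← lintegral_add_compl _ (measurableSet_Ioi (a := (0 : ℝ))), hpos, Set.compl_Ioi,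
    setLIntegral_congr Iio_ae_eq_Iic.symm, setLIntegral_Iio_zero]
  simp only [abs_neg, hpos, two_mul]

/-- The factor `2` over the half-line is the shape produced by `lintegral_comp_abs` when the
Gaussian is folded by `|z|`. -/
theorem withDensity_limitPDFU_apply (s : Set ℝ) (hs : MeasurableSet s) :
    (volume.withDensity fun u => ENNReal.ofReal (limitPDFU u)) s =
      2 * ∫⁻ x in Set.Ioi 0, s.indicator
        (fun x => ENNReal.ofReal (π⁻¹ * Real.exp (-(x ^ 2 / π)))) x := by
  rw [withDensity_apply _ hs, ← lintegral_indicator hs,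
    ← lintegral_const_mul' _ _ ENNReal.ofNat_ne_top, ← lintegral_indicator measurableSet_Ioi]
  refine lintegral_congr fun x => ?_
  by_cases hx : 0 < x
  · have hx' : x ∈ Set.Ioi (0 : ℝ) := hx
    by_cases hxs : x ∈ s
    · simp only [hxs, hx', Set.indicator_of_mem, limitPDFU, hx, if_true]
      rw [← ENNReal.ofReal_ofNat, ← ENNReal.ofReal_mul (by norm_num)]
      congr 1
      ring
    · simp [hxs, Set.indicator]
  · by_cases hxs : x ∈ s <;> simp [hx, hxs, limitPDFU]

theorem halfNormalMeasure_pi_div_two :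
    halfNormalMeasure (π / 2).toNNReal =
      volume.withDensity fun u => ENNReal.ofReal (limitPDFU u) := by
  have habs : Measurable fun z : ℝ => |z| := by fun_prop
  ext s hs
  rw [withDensity_limitPDFU_apply s hs, ← lintegral_comp_abs, halfNormalMeasure,
    Measure.map_apply habs hs,
    gaussianReal_of_var_ne_zero _ pi_div_two_toNNReal_ne_zero,
    withDensity_apply _ (habs hs), ← lintegral_indicator (habs hs)]
  refine lintegral_congr fun x => ?_
  simp only [Set.indicator, gaussianPDF, gaussianPDFReal_pi_div_two, sq_abs]
  rfl

theorem image_inv_sq_Ioi_inter_preimage (s : Set ℝ) :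
    (fun u : ℝ => (u ^ 2)⁻¹) '' (Set.Ioi 0 ∩ (fun u : ℝ => (u ^ 2)⁻¹) ⁻¹' s) = Set.Ioi 0 ∩ s := by
  rw [Set.image_inter_preimage]
  congr 1
  ext w
  constructor
  · rintro ⟨u, hu, rfl⟩
    have hu' : (0 : ℝ) < u := hu
    exact Set.mem_Ioi.2 (by positivity)
  · intro hw
    have hw' : (0 : ℝ) < w := hw
    refine ⟨(√w)⁻¹, Set.mem_Ioi.2 (by positivity), ?_⟩
    simp [Real.sq_sqrt hw'.le]

theorem injOn_inv_sq : Set.InjOn (fun u : ℝ => (u ^ 2)⁻¹) (Set.Ioi 0) := by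
  intro x hx y hy h
  have hx' : (0 : ℝ) < x := hx
  have hy' : (0 : ℝ) < y := hy
  exact (pow_left_inj₀ hx'.le hy'.le two_ne_zero).1 (inv_injective h)

theorem hasDerivAt_inv_sq {u : ℝ} (hu : u ≠ 0) :
    HasDerivAt (fun u : ℝ => (u ^ 2)⁻¹) (-(2 / u ^ 3)) u := by
  refine ((hasDerivAt_pow 2 u).fun_inv (pow_ne_zero 2 hu)).congr_deriv ?_
  field_simp
  norm_num [mul_comm]

theorem two_div_cube_mul_limitPDFW_inv_sq {u : ℝ} (hu : 0 < u) :
    2 / u ^ 3 * limitPDFW (u ^ 2)⁻¹ = limitPDFU u := by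
  have hπ := Real.pi_pos
  have hw : 0 < (u ^ 2)⁻¹ := by positivity
  have hpow : ((u ^ 2)⁻¹ : ℝ) ^ (3 / 2 : ℝ) = (u ^ 3)⁻¹ := by
    rw [Real.inv_rpow (by positivity), ← Real.rpow_natCast u 2, ← Real.rpow_mul hu.le,
      ← Real.rpow_natCast u 3]
    norm_num
  rw [limitPDFW, limitPDFU, if_pos hw, if_pos hu, hpow,
    show -(1 / (π * (u ^ 2)⁻¹)) = -(u ^ 2 / π) by field_simp]
  field_simp

theorem map_inv_sq_withDensity_limitPDFU :
    (volume.withDensity fun u => ENNReal.ofReal (limitPDFU u)).map (fun u => (u ^ 2)⁻¹) =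
      volume.withDensity fun w => ENNReal.ofReal (limitPDFW w) := by
  have hm : Measurable fun u : ℝ => (u ^ 2)⁻¹ := by fun_prop
  -- Both densities vanish off `(0, ∞)`, and `u ↦ 1 / u ^ 2` is injective only after restriction to
  -- that half-line.
  have hrestr : ∀ (f : ℝ → ℝ), (∀ x, ¬ 0 < x → f x = 0) → ∀ s : Set ℝ, MeasurableSet s →
      (volume.withDensity fun u => ENNReal.ofReal (f u)) s =
        ∫⁻ x in Set.Ioi 0 ∩ s, ENNReal.ofReal (f x) := by
    intro f hf s hs
    rw [withDensity_apply _ hs, ← lintegral_indicator hs,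
      ← lintegral_indicator (measurableSet_Ioi.inter hs)]
    refine lintegral_congr fun x => ?_
    by_cases hxs : x ∈ s <;> by_cases hx : 0 < x <;> simp [hxs, hx, hf]
  ext s hs
  rw [Measure.map_apply hm hs, hrestr limitPDFU (fun x hx => if_neg hx) _ (hm hs),
    hrestr limitPDFW (fun x hx => if_neg hx) _ hs, ← image_inv_sq_Ioi_inter_preimage s,
    lintegral_image_eq_lintegral_abs_deriv_mul (measurableSet_Ioi.inter (hm hs))
      (fun x hx => (hasDerivAt_inv_sq (ne_of_gt hx.1)).hasDerivWithinAt)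
      (injOn_inv_sq.mono Set.inter_subset_left)]
  refine setLIntegral_congr_fun (measurableSet_Ioi.inter (hm hs)) fun x hx => ?_
  have hx' : (0 : ℝ) < x := hx.1
  simp only [abs_neg]
  rw [abs_of_pos (by positivity), ← ENNReal.ofReal_mul (by positivity),
    two_div_cube_mul_limitPDFW_inv_sq hx']

theorem map_inv_sq_gaussianReal :
    (gaussianReal 0 (π / 2).toNNReal).map (fun z => (z ^ 2)⁻¹) =
      volume.withDensity fun w => ENNReal.ofReal (limitPDFW w) := by
  rw [← map_inv_sq_withDensity_limitPDFU, ← halfNormalMeasure_pi_div_two, halfNormalMeasure,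
    Measure.map_map (by fun_prop) (by fun_prop)]
  congr 1
  ext z
  simp

/-! ### Characteristic function of `W`, stability and continuous mapping -/

theorem charFun_map_inv_sq_gaussianReal (t : ℝ) :
    charFun ((gaussianReal 0 (π / 2).toNNReal).map fun z => (z ^ 2)⁻¹) t =
      Complex.exp (-2 * (-(Complex.I * t) / π) ^ (1 / 2 : ℂ)) := by
  rw [← integral_cexp_neg_mul_inv_sq_gaussianReal (by simp), charFun_apply_real,
    integral_map (by fun_prop) (by fun_prop)]
  refine integral_congr_ae (Eventually.of_forall fun z => ?_)
  simp only
  congr 1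
  ring

/-- A probability law on `ℝ` whose characteristic function is `exp (-2 √(-it / c))` is strictly
stable of index `1 / 2` as soon as it has no atoms. -/
theorem isStrictlyStable_half_of_charFun {μ : Measure ℝ} [IsProbabilityMeasure μ]
    (hμ : ∀ x, μ {x} = 0) {c : ℂ}
    (h : ∀ t : ℝ, charFun μ t = Complex.exp (-2 * (-(Complex.I * t) / c) ^ (1 / 2 : ℂ))) :
    IsStrictlyStable (1 / 2) μ where
  index_pos := by norm_num
  isProbabilityMeasure := inferInstance
  nondegenerate x hx := by
    have := hμ x
    rw [hx] at this
    simp at this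
  map_eq a b ha hb := by
    -- Scaling by `r` multiplies the exponent by `√r`; independence adds exponents, giving the
    -- factor `√a + √b`, which is scaling by its square.
    have hscale : ∀ {r : ℝ}, 0 < r → ∀ t : ℝ, charFun μ (r * t) =
        Complex.exp (√r * (-2 * (-(Complex.I * t) / c) ^ (1 / 2 : ℂ))) := by
      intro r hr t
      rw [h, show -(Complex.I * ((r * t : ℝ) : ℂ)) / c = r * (-(Complex.I * t) / c) by
        push_cast; ring, ofReal_mul_cpow_half hr]
      ring_nf
    have hab : ((a ^ (1 / 2 : ℝ) + b ^ (1 / 2 : ℝ)) ^ (1 / (1 / 2) : ℝ) : ℝ) = (√a + √b) ^ 2 := by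
      rw [Real.sqrt_eq_rpow, Real.sqrt_eq_rpow, ← Real.rpow_natCast]
      norm_num
    have hpos : 0 < √a + √b := add_pos (Real.sqrt_pos.2 ha) (Real.sqrt_pos.2 hb)
    have hpair : (fun p : ℝ × ℝ => a * p.1 + b * p.2) =
        (fun p : ℝ × ℝ => p.1 + p.2) ∘ Prod.map (fun x => a * x) (fun x => b * x) := rfl
    have : IsProbabilityMeasure (μ.map fun x => a * x) :=
      Measure.isProbabilityMeasure_map (by fun_prop)
    have : IsProbabilityMeasure (μ.map fun x => b * x) :=
      Measure.isProbabilityMeasure_map (by fun_prop)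
    refine Measure.ext_of_charFun (funext fun t => ?_)
    rw [hab, charFun_map_mul, hscale (by positivity), Real.sqrt_sq hpos.le, hpair,
      ← Measure.map_map (by fun_prop) (by fun_prop),
      ← Measure.map_prod_map _ _ (by fun_prop) (by fun_prop), charFun_map_add_prod_eq_mul,
      Pi.mul_apply, charFun_map_mul, charFun_map_mul, hscale ha, hscale hb, ← Complex.exp_add]
    push_cast
    ring_nf

/-- **Continuous mapping theorem** for a map that is continuous on an open set carrying the
limit law. -/
theorem tendstoInDistribution_comp_of_continuousOn {ι E F Ω' : Type*} {Ω : ι → Type*}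
    {m : ∀ i, MeasurableSpace (Ω i)} {μ : (i : ι) → Measure (Ω i)}
    [∀ i, IsProbabilityMeasure (μ i)] {m' : MeasurableSpace Ω'} {μ' : Measure Ω'}
    [IsProbabilityMeasure μ'] [MeasurableSpace E] [TopologicalSpace E] [OpensMeasurableSpace E]
    [HasOuterApproxClosed E] [MeasurableSpace F] [TopologicalSpace F] [OpensMeasurableSpace F]
    {X : (i : ι) → Ω i → E} {Z : Ω' → E} {l : Filter ι} [l.IsCountablyGenerated]
    {g : E → F} {O : Set E} (hO : IsOpen O) (hg : ContinuousOn g O) (hgm : Measurable g)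
    (hZ : ∀ᵐ ω ∂μ', Z ω ∈ O) (h : TendstoInDistribution X l Z μ μ') :
    TendstoInDistribution (fun n => g ∘ X n) l (g ∘ Z) μ μ' where
  forall_aemeasurable n := hgm.comp_aemeasurable (h.forall_aemeasurable n)
  aemeasurable_limit := hgm.comp_aemeasurable h.aemeasurable_limit
  tendsto := by
    -- Portmanteau on open sets: `g ⁻¹' G` need not be open, but its trace on `O` is, and the limit
    -- law loses no mass there.
    refine tendsto_of_forall_isOpen_le_liminf' fun G hG => ?_
    have hOG : IsOpen (O ∩ g ⁻¹' G) := hg.isOpen_inter_preimage hO hG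
    have key := ProbabilityMeasure.le_liminf_measure_open_of_tendsto h.tendsto hOG
    simp only [ProbabilityMeasure.coe_mk] at key ⊢
    refine le_trans (le_of_eq ?_) (key.trans (liminf_le_liminf (Eventually.of_forall fun n => ?_)))
    · rw [Measure.map_apply_of_aemeasurable (hgm.comp_aemeasurable h.aemeasurable_limit)
        hG.measurableSet, Measure.map_apply_of_aemeasurable h.aemeasurable_limit hOG.measurableSet]
      refine measure_congr ?_
      filter_upwards [hZ] with ω hω
      exact propext ⟨fun hx => ⟨hω, hx⟩, fun hx => hx.2⟩
    · rw [Measure.map_apply_of_aemeasurable (hgm.comp_aemeasurable (h.forall_aemeasurable n))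
        hG.measurableSet, Measure.map_apply_of_aemeasurable (h.forall_aemeasurable n)
        hOG.measurableSet]
      exact measure_mono fun ω hω => hω.2

/-! ### Convergence of the normalized sums -/

theorem charFun_map_sum_sq_div_sq {Ω : Type*} [MeasurableSpace Ω] {P : Measure Ω}
    {X : ℕ → Ω → ℝ} {ν : Measure ℝ} (hlaw : ∀ i, HasLaw (X i) ν P) (hindep : iIndepFun X P)
    (n : ℕ) (t : ℝ) :
    charFun (P.map fun ω => (∑ i ∈ Finset.range n, X i ω ^ 2) / (n : ℝ) ^ 2) t =
      charFun (ν.map fun x => x ^ 2) (((n : ℝ) ^ 2)⁻¹ * t) ^ n := by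
  have hm : ∀ i, AEMeasurable (fun ω => X i ω ^ 2) P := fun i => (hlaw i).aemeasurable.pow_const 2
  have hmap : ∀ i, P.map (fun ω => X i ω ^ 2) = ν.map fun x => x ^ 2 := by
    intro i
    rw [← (hlaw i).map_eq, AEMeasurable.map_map_of_aemeasurable (by fun_prop)
      (hlaw i).aemeasurable]
    rfl
  have hind : iIndepFun (fun i ω => X i ω ^ 2) P :=
    hindep.comp (fun _ x => x ^ 2) fun _ => by fun_prop
  simp_rw [div_eq_inv_mul]
  rw [charFun_map_mul_comp (Finset.aemeasurable_fun_sum _ fun i _ => hm i),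
    (hind.restrict _).charFun_map_fun_finsetSum_eq_prod fun i _ => hm i]
  simp [hmap]

theorem mainTheorem1 {Ω : Type*} [MeasurableSpace Ω] (P : Measure Ω) [IsProbabilityMeasure P]
    (X : ℕ → Ω → ℝ) (hlaw : ∀ i, HasLaw (X i) (cauchyMeasure 0 1) P) (hindep : iIndepFun X P) :
    ∃ (Ω' : Type) (_ : MeasurableSpace Ω') (P' : Measure Ω') (_ : IsProbabilityMeasure P')
      (W : Ω' → ℝ),
      -- convergence in distribution of the normalized sums of squares to `W`
      TendstoInDistribution
        (fun (n : ℕ) ω => (∑ i ∈ Finset.range n, X i ω ^ 2) / (n : ℝ) ^ 2)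
        atTop W (fun _ => P) P' ∧
      -- the law of `W`: characteristic function, density, Lévy law, stability of index `1/2`
      (∀ t : ℝ, charFun (P'.map W) t =
        Complex.exp (-2 * (-(Complex.I * (t : ℂ)) / (π : ℂ)) ^ (1 / 2 : ℂ))) ∧
      HasLaw W (volume.withDensity fun w => ENNReal.ofReal (limitPDFW w)) P' ∧
      HasLaw W (levyMeasure (2 / π)) P' ∧
      IsStrictlyStable (1 / 2) (P'.map W) ∧
      (∀ᵐ ω ∂P', 0 < W ω) ∧
      -- convergence in distribution of the reciprocal square roots to `U = 1 / √W`
      TendstoInDistribution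
        (fun (n : ℕ) ω => (n : ℝ) / √(∑ i ∈ Finset.range n, X i ω ^ 2))
        atTop (fun ω => 1 / √(W ω)) (fun _ => P) P' ∧
      -- the law of `U`: density and half-normal law
      HasLaw (fun ω => 1 / √(W ω))
        (volume.withDensity fun u => ENNReal.ofReal (limitPDFU u)) P' ∧
      HasLaw (fun ω => 1 / √(W ω)) (halfNormalMeasure (π / 2).toNNReal) P' := by
  -- The limit lives on `ℝ` with this Gaussian law, with `W z = 1 / z ^ 2`, so that `1 / √W` is
  -- exactly `|z|`.
  set γ := gaussianReal 0 (π / 2).toNNReal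
  have hlawW : HasLaw (fun z : ℝ => (z ^ 2)⁻¹)
      (volume.withDensity fun w => ENNReal.ofReal (limitPDFW w)) γ :=
    ⟨by fun_prop, map_inv_sq_gaussianReal⟩
  have hprob : IsProbabilityMeasure (γ.map fun z : ℝ => (z ^ 2)⁻¹) :=
    Measure.isProbabilityMeasure_map (by fun_prop)
  have hpos : ∀ᵐ z ∂γ, 0 < (z ^ 2)⁻¹ := by
    have : NullSingletonClass γ := nullSingletonClass_gaussianReal pi_div_two_toNNReal_ne_zero
    have h0 : ∀ᵐ z ∂γ, z ≠ 0 := by simp [ae_iff, measure_singleton]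
    filter_upwards [h0] with z hz
    positivity
  have hlawU : HasLaw (fun z : ℝ => 1 / √((z ^ 2)⁻¹)) (halfNormalMeasure (π / 2).toNNReal) γ := by
    have h : (fun z : ℝ => 1 / √((z ^ 2)⁻¹)) = fun z => |z| := by
      ext z
      rw [Real.sqrt_inv, Real.sqrt_sq_eq_abs, one_div, inv_inv]
    rw [h]
    exact ⟨by fun_prop, rfl⟩
  have hconv : TendstoInDistribution
      (fun (n : ℕ) ω => (∑ i ∈ Finset.range n, X i ω ^ 2) / (n : ℝ) ^ 2)
      atTop (fun z : ℝ => (z ^ 2)⁻¹) (fun _ => P) γ :=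
    { forall_aemeasurable := fun n => (Finset.aemeasurable_fun_sum _ fun i _ =>
        (hlaw i).aemeasurable.pow_const 2).div_const _
      tendsto := by
        refine ProbabilityMeasure.tendsto_iff_tendsto_charFun.2 fun t => ?_
        simp only [ProbabilityMeasure.coe_mk]
        rw [charFun_map_inv_sq_gaussianReal]
        simp_rw [charFun_map_sum_sq_div_sq hlaw hindep]
        exact tendsto_charFun_map_sq_cauchyMeasure_pow t }
  refine ⟨ℝ, inferInstance, γ, inferInstance, fun z => (z ^ 2)⁻¹, hconv,
    charFun_map_inv_sq_gaussianReal, hlawW, ?_, ?_, hpos, ?_, ?_, hlawU⟩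
  · rwa [levyMeasure, levyPDFReal_two_div_pi]
  · refine isStrictlyStable_half_of_charFun (fun x => ?_) charFun_map_inv_sq_gaussianReal
    rw [map_inv_sq_gaussianReal]
    exact withDensity_absolutelyContinuous _ _ Real.volume_singleton
  -- The map `1 / √x` is discontinuous at `0`, but `W` is almost surely in `(0, ∞)`.
  · have h := tendstoInDistribution_comp_of_continuousOn (g := fun x : ℝ => 1 / √x)
      (O := Set.Ioi 0) isOpen_Ioi
      (continuousOn_const.div Real.continuous_sqrt.continuousOn fun x hx =>
        (Real.sqrt_pos.2 hx).ne') (by fun_prop) hpos hconv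
    refine h.congr (fun n => Eventually.of_forall fun ω => ?_) (ae_eq_refl _)
    simp only [Function.comp_apply]
    rw [Real.sqrt_div' _ (sq_nonneg _), Real.sqrt_sq n.cast_nonneg, one_div_div]
  · rw [← halfNormalMeasure_pi_div_two]
    exact hlawU
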